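/- An instance of Submodular Cover on a ground set $U$ with $|U|=n$ consists of a nonnegative submodular function $f:2^U\to\mathbb{R}_{\ge 0}$, a cost function $w:U\to\mathbb{R}_{\ge 0}$ and a threshold $\tau\le\max_{X\subseteq U}f(X)$ (the task being to find $X\subseteq U$ of minimum cost $\sum_{x\in X}w(x)$ with $f(X)\ge\tau$). It is symmetric if $f(U\setminus X)=f(X)$ for all $X\subseteq U$. A value-query algorithm is given $U$, $w$ and $\tau$, accesses $f$ only by adaptively asking for values $f(S)$ of subsets $S\subseteq U$, may be randomized, is otherwise computationally unrestricted, and returns a subset of $U$. Theorem. There is an absolute constant $c>0$ such that for every $\varepsilon>0$ and all sufficiently large $n$ (depending on $\varepsilon$) the following holds for a ground set $U$ of size $n$: there is no (adaptive, possibly randomized) value-query algorithm that on every symmetric instance $(f,w,\tau)$ of Submodular Cover on $U$ makes fewer than $$c\cdot\frac{\ln(1+\varepsilon)\,e^{\varepsilon^2 n}}{\ln n}$$ queries and returns a set $X\subseteq U$ with $\mathbb{E}[f(X)]\ge\left(\tfrac12+\varepsilon\right)\tau$. -/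

import Mathlib

open MeasureTheory

/-- Submodularity of a set function, as diminishing marginal gains. -/
def IsSubmodular {U : Type*} [DecidableEq U] (f : Finset U → ℝ) : Prop :=
  ∀ A B : Finset U, A ⊆ B → ∀ x, x ∉ B → f (insert x B) - f B ≤ f (insert x A) - f A

/-- A set function is symmetric if every set has the same value as its complement. -/
def IsSymmetricSetFun {U : Type*} [Fintype U] [DecidableEq U] (f : Finset U → ℝ) : Prop :=
  ∀ X : Finset U, f Xᶜ = f X

/-- An instance of Submodular Cover on the ground set `U`: a nonnegative submodular `f`,
nonnegative costs `w`, and a threshold `τ ≤ max f`. The optimization task is to minimize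
`∑ x ∈ X, w x` over the sets `X` with `f X ≥ τ`. -/
structure SubmodularCover (U : Type*) [Fintype U] [DecidableEq U] where
  f : Finset U → ℝ
  f_nonneg : ∀ X, 0 ≤ f X
  f_submodular : IsSubmodular f
  w : U → ℝ
  w_nonneg : ∀ x, 0 ≤ w x
  τ : ℝ
  τ_le_max : ∃ X, τ ≤ f X

/-- A deterministic adaptive value-query procedure on subsets of `U`: it either stops with an
output set, or asks for the value of a set and continues in a way that may depend arbitrarily on
the answer. Computation between queries is free. -/
inductive QueryProc (U : Type*) where
  | output (S : Finset U) : QueryProc U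
  | query (S : Finset U) (next : ℝ → QueryProc U) : QueryProc U

namespace QueryProc

/-- The set that the procedure returns when its queries are answered by `f`. -/
def run {U : Type*} (f : Finset U → ℝ) : QueryProc U → Finset U
  | output S => S
  | query S next => run f (next (f S))

/-- The number of queries that the procedure makes when they are answered by `f`. -/
def numQueries {U : Type*} (f : Finset U → ℝ) : QueryProc U → ℕ
  | output _ => 0
  | query S next => numQueries f (next (f S)) + 1

end QueryProc

/-- A randomized adaptive value-query algorithm for Submodular Cover on `U`. It is given the costs
and the threshold explicitly and accesses the set function only by value queries. All its
randomness is carried by a seed `ω`, drawn from an arbitrary probability space (a one-point space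
gives the deterministic algorithms). -/
structure RandQueryAlg.{v, u} (U : Type v) where
  Ω : Type u
  [mΩ : MeasurableSpace Ω]
  P : Measure Ω
  [isProb : IsProbabilityMeasure P]
  proc : (w : U → ℝ) → (τ : ℝ) → Ω → QueryProc U
  measurable_output : ∀ (w : U → ℝ) (τ : ℝ) (f : Finset U → ℝ) (S : Finset U),
    MeasurableSet {ω | (proc w τ ω).run f = S}

namespace RandQueryAlg

attribute [instance] RandQueryAlg.mΩ RandQueryAlg.isProb

variable {U : Type*} [Fintype U] [DecidableEq U]

/-- The output of the algorithm on an instance, for the seed `ω`. -/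
def out (𝒜 : RandQueryAlg U) (I : SubmodularCover U) (ω : 𝒜.Ω) : Finset U :=
  (𝒜.proc I.w I.τ ω).run I.f

/-- The number of queries to `f` of the algorithm on an instance, for the seed `ω`. -/
def queries (𝒜 : RandQueryAlg U) (I : SubmodularCover U) (ω : 𝒜.Ω) : ℕ :=
  (𝒜.proc I.w I.τ ω).numQueries I.f

/-- The expected `f` value of the output of the algorithm on an instance. -/
noncomputable def expectedValue (𝒜 : RandQueryAlg U) (I : SubmodularCover U) : ℝ :=
  ∫ ω, I.f (𝒜.out I ω) ∂𝒜.P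

end RandQueryAlg

/-!
The proof hides a set `C`, half of the ground set, in an objective that looks like the cut function
`|S| (n - |S|)` of the complete graph. Write `d` for half the inner product of the `±1` indicators
of `C` and `S`. The function `hiddenCut T C` adds to the complete-graph cut the squared distance
from `d` to `[-T, T]`. Moving one element in or out of `S` changes `d` by `±1`, so the bump has
second differences at most `2`, which the `-2` of the clique part absorbs: the sum is submodular,
and it is symmetric because complementing `S` negates `d` (`hiddenCut_submodular`,
`hiddenCut_symm`).

With `T = 3 / 4 * ε * n` two things happen for `ε ≤ 1 / 2`. The set `C` itself has value about
`n ^ 2 / 4 * (1 + (1 - 3 / 2 * ε) ^ 2)`, and `1 / 2 + ε` times this is larger than `n ^ 2 / 4`, the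
maximum of the complete-graph cut, by a constant multiple of `n ^ 2`. On the other hand, for a fixed
`S` and a uniform set `C`, the inner product is a sum of `n` independent signs, so `|d| > T` has
probability at most `2 * exp (-9 / 8 * ε ^ 2 * n)` (`card_lt_abs_correlation_le`). Conditioning on
`|C| = n / 2` costs only a factor `n + 1` (`two_pow_le_mul_choose_half`), so the exponent stays
strictly better than `ε ^ 2 * n`.

Run the algorithm, for a fixed seed, against the complete-graph cut. Unless one of the probed sets
is correlated with `C`, the run on `hiddenCut T C` is identical and its output misses the bump
(`QueryProc.run_mem_probes`). By the union bound this holds for all but an exponentially small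
fraction of the sets `C`, so the average over `C` of the expected value of the output is too small
(`sum_expectedValue_hiddenInstance_le`, `eventually_average_lt`). The constant `c = 1` works. For
`ε > 1 / 2` the requirement would exceed the maximum of the objective when `τ` is that maximum.
-/

section

variable {U : Type*} [DecidableEq U]

/-! ### Submodularity and the excess function -/

/-- It is enough to compare the marginal gains before and after adding one more element. -/
lemma isSubmodular_of_pairs {f : Finset U → ℝ}
    (h : ∀ (A : Finset U) (x y : U), x ∉ A → y ∉ A → x ≠ y →
      f (insert x (insert y A)) - f (insert y A) ≤ f (insert x A) - f A) :
    IsSubmodular f := by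
  intro A B hAB x hx
  have key : ∀ D : Finset U, x ∉ A ∪ D →
      f (insert x (A ∪ D)) - f (A ∪ D) ≤ f (insert x A) - f A := by
    intro D
    induction D using Finset.induction_on with
    | empty => simp
    | insert y D _ ih =>
      rw [Finset.union_insert]
      intro hxD
      rw [Finset.mem_insert, not_or] at hxD
      by_cases hy : y ∈ A ∪ D
      · rw [Finset.insert_eq_of_mem hy]; exact ih hxD.2
      · exact (h _ x y hxD.2 hy hxD.1).trans (ih hxD.2)
  have := key B (by rwa [Finset.union_eq_right.2 hAB])
  rwa [Finset.union_eq_right.2 hAB] at this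

/-- The squared distance from `y` to the interval `[-T, T]`, for `T ≥ 0`. -/
noncomputable def excess (T y : ℝ) : ℝ := max (|y| - T) 0 ^ 2

/-- Midpoint convexity of `excess T`. -/
lemma two_mul_excess_le (T y : ℝ) : 2 * excess T y ≤ excess T (y + 1) + excess T (y - 1) := by
  unfold excess
  have h : 2 * max (|y| - T) 0 ≤ max (|y + 1| - T) 0 + max (|y - 1| - T) 0 := by
    have h1 : 2 * |y| ≤ |y + 1| + |y - 1| := by
      have := abs_add_le (y + 1) (y - 1)
      rw [show y + 1 + (y - 1) = 2 * y by ring, abs_mul, abs_two] at this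
      exact this
    rcases max_cases (|y| - T) 0 with ⟨h, -⟩ | ⟨h, -⟩ <;> rw [h] <;>
    linarith [le_max_left (|y + 1| - T) 0, le_max_right (|y + 1| - T) 0,
      le_max_left (|y - 1| - T) 0, le_max_right (|y - 1| - T) 0]
  nlinarith [sq_nonneg (max (|y + 1| - T) 0 - max (|y - 1| - T) 0), le_max_right (|y| - T) 0]

lemma excess_le_sq {T : ℝ} {y z : ℝ} (hz : |z| ≤ T) : excess T y ≤ (y - z) ^ 2 := by
  unfold excess
  rw [← sq_abs (y - z)]
  refine pow_le_pow_left₀ (le_max_right _ _) (max_le ?_ (abs_nonneg _)) 2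
  have := abs_sub_abs_le_abs_sub y z
  linarith

lemma exists_excess_eq {T : ℝ} (hT : 0 ≤ T) (y : ℝ) : ∃ z, |z| ≤ T ∧ excess T y = (y - z) ^ 2 := by
  unfold excess
  rcases le_or_gt |y| T with h | h
  · exact ⟨y, h, by rw [max_eq_right (by linarith)]; ring⟩
  · rcases abs_cases y with ⟨h1, h2⟩ | ⟨h1, h2⟩
    · exact ⟨T, (abs_of_nonneg hT).le, by rw [max_eq_left (by linarith), h1]⟩
    · exact ⟨-T, by rw [abs_neg, abs_of_nonneg hT],
        by rw [max_eq_left (by linarith), h1]; ring⟩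

/-- The nearest point of `[-T, T]` to `y` is a competitor for `y + 1` and `y - 1`, so `excess T`
has second differences at most those of a square. -/
lemma excess_add_excess_le {T : ℝ} (hT : 0 ≤ T) (y : ℝ) :
    excess T (y + 1) + excess T (y - 1) ≤ 2 * excess T y + 2 := by
  obtain ⟨z, hz, h⟩ := exists_excess_eq hT y
  rw [h]
  linarith [excess_le_sq (y := y + 1) hz, excess_le_sq (y := y - 1) hz]

lemma excess_eq_zero {T y : ℝ} (h : |y| ≤ T) : excess T y = 0 := by
  simp [excess, h]

lemma excess_le_of_abs_le {T y z : ℝ} (h : |y| ≤ z) : excess T y ≤ excess T z :=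
  pow_le_pow_left₀ (le_max_right _ _)
    (max_le_max (by linarith [h.trans (le_abs_self z)]) le_rfl) 2

end

section

variable {U : Type*} [Fintype U]

/-! ### The cut function of the complete graph -/

/-- The cut function of the complete graph on `U`; it sees only the size of `S`. -/
noncomputable def cliqueCut (S : Finset U) : ℝ := S.card * (Fintype.card U - S.card)

lemma cliqueCut_nonneg (S : Finset U) : 0 ≤ cliqueCut S :=
  mul_nonneg (Nat.cast_nonneg _) (sub_nonneg.2 (by exact_mod_cast S.card_le_univ))

lemma cliqueCut_le (S : Finset U) :
    cliqueCut S ≤ (Fintype.card U / 2 : ℕ) * ((Fintype.card U : ℝ) - (Fintype.card U / 2 : ℕ)) := by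
  unfold cliqueCut
  set n := Fintype.card U
  set m := n / 2
  have hS : S.card ≤ m ∨ m + 1 ≤ S.card := by omega
  have h1 : (2 * m : ℝ) ≤ n := by exact_mod_cast (by omega : 2 * m ≤ n)
  have h2 : (n : ℝ) ≤ 2 * m + 1 := by exact_mod_cast (by omega : n ≤ 2 * m + 1)
  rcases hS with h | h
  · have h : (S.card : ℝ) ≤ m := by exact_mod_cast h
    nlinarith
  · have h : (m : ℝ) + 1 ≤ S.card := by exact_mod_cast h
    nlinarith

end

/-! ### Correlation of sets -/

section

variable {U : Type*} [DecidableEq U]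

/-- The indicator of `A` with values `1` on `A` and `-1` off `A`. -/
def signOf (A : Finset U) (x : U) : ℝ := if x ∈ A then 1 else -1

lemma signOf_eq_or (A : Finset U) (x : U) : signOf A x = 1 ∨ signOf A x = -1 := by
  unfold signOf; split_ifs <;> simp

variable [Fintype U]

/-- The inner product of the `±1` indicators of `C` and `S`. If `C` is half of `U`, this is twice
the difference of `|S ∩ C|` and `|S \ C|`. -/
def correlation (C S : Finset U) : ℝ := ∑ x, signOf C x * signOf S x

lemma correlation_compl (C S : Finset U) : correlation C Sᶜ = -correlation C S := by
  unfold correlation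
  rw [← Finset.sum_neg_distrib]
  refine Finset.sum_congr rfl fun x _ => ?_
  by_cases h : x ∈ S <;> simp [signOf, h]

lemma correlation_self (C : Finset U) : correlation C C = Fintype.card U := by
  have : ∀ x, signOf C x * signOf C x = 1 := fun x => by
    rcases signOf_eq_or C x with h | h <;> rw [h] <;> norm_num
  simp [correlation, this]

lemma abs_correlation_le (C S : Finset U) : |correlation C S| ≤ Fintype.card U := by
  refine (Finset.abs_sum_le_sum_abs _ _).trans ?_
  have : ∀ x, |signOf C x * signOf S x| = 1 := fun x => by
    rcases signOf_eq_or C x with h | h <;> rcases signOf_eq_or S x with h' | h' <;>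
      rw [h, h'] <;> norm_num
  simp [this]

lemma correlation_insert (C : Finset U) {S : Finset U} {x : U} (hx : x ∉ S) :
    correlation C (insert x S) = correlation C S + 2 * signOf C x := by
  unfold correlation
  rw [← Finset.add_sum_erase _ _ (Finset.mem_univ x),
    ← Finset.add_sum_erase (a := x) (f := fun y => signOf C y * signOf S y) _ (Finset.mem_univ x)]
  have : ∀ y ∈ Finset.univ.erase x,
      signOf C y * signOf (insert x S) y = signOf C y * signOf S y := by
    intro y hy
    simp [signOf, Finset.ne_of_mem_erase hy]
  rw [Finset.sum_congr rfl this]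
  have h1 : signOf (insert x S) x = 1 := by simp [signOf]
  have h2 : signOf S x = -1 := by simp [signOf, hx]
  rw [h1, h2]
  ring

/-! ### The hidden cut functions -/

/-- The complete-graph cut function with a bump on the sets whose correlation with `C` exceeds
`2 * T` in absolute value. For `T = 0` and `C` half of `U`, this is the cut function of the
complete bipartite graph between `C` and its complement, with edges of weight two. -/
noncomputable def hiddenCut (T : ℝ) (C S : Finset U) : ℝ :=
  cliqueCut S + excess T (correlation C S / 2)

lemma card_compl_real (S : Finset U) : (Sᶜ.card : ℝ) = Fintype.card U - S.card := by
  rw [Finset.card_compl, Nat.cast_sub (Finset.card_le_univ S)]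

lemma hiddenCut_symm (T : ℝ) (C : Finset U) : IsSymmetricSetFun (hiddenCut T C) := by
  intro S
  simp only [hiddenCut, cliqueCut, correlation_compl, card_compl_real, excess, neg_div, abs_neg]
  ring

lemma hiddenCut_nonneg (T : ℝ) (C S : Finset U) : 0 ≤ hiddenCut T C S :=
  add_nonneg (cliqueCut_nonneg S) (sq_nonneg _)

/-- The clique part has second difference `-2` in every pair of directions, and the second
difference of the bump is at most `2`: the half correlation moves by `±1` in each direction, so it
is a central second difference of `excess T` or the negative of one. -/
lemma hiddenCut_submodular {T : ℝ} (hT : 0 ≤ T) (C : Finset U) :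
    IsSubmodular (hiddenCut T C) := by
  refine isSubmodular_of_pairs fun A x y hx hy hxy => ?_
  have hx' : x ∉ insert y A := by simp [hx, hxy]
  simp only [hiddenCut, cliqueCut, correlation_insert C hx', correlation_insert C hx,
    correlation_insert C hy, Finset.card_insert_of_notMem hx', Finset.card_insert_of_notMem hx,
    Finset.card_insert_of_notMem hy]
  push_cast
  have key : ∀ a b d : ℝ, (a = 1 ∨ a = -1) → (b = 1 ∨ b = -1) →
      excess T ((d + 2 * b + 2 * a) / 2) + excess T (d / 2) ≤
        excess T ((d + 2 * b) / 2) + excess T ((d + 2 * a) / 2) + 2 := by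
    intro a b d ha hb
    rcases ha with rfl | rfl <;> rcases hb with rfl | rfl
    · have := excess_add_excess_le hT (d / 2 + 1)
      ring_nf at this ⊢; linarith
    · have := two_mul_excess_le T (d / 2)
      ring_nf at this ⊢; linarith
    · have := two_mul_excess_le T (d / 2)
      ring_nf at this ⊢; linarith
    · have := excess_add_excess_le hT (d / 2 - 1)
      ring_nf at this ⊢; linarith
  have := key _ _ (correlation C A) (signOf_eq_or C x) (signOf_eq_or C y)
  linarith

/-! ### Concentration of the correlation with a random set -/

lemma sum_exp_correlation (θ : ℝ) (S : Finset U) :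
    ∑ C : Finset U, Real.exp (θ * correlation C S) = (2 * Real.cosh θ) ^ Fintype.card U := by
  have h : ∀ x ∈ (Finset.univ : Finset U),
      2 * Real.cosh θ = Real.exp (θ * signOf S x) + Real.exp (-(θ * signOf S x)) := by
    intro x _
    rw [Real.cosh_eq]
    rcases signOf_eq_or S x with h | h <;> rw [h] <;> ring_nf
  rw [← Finset.card_univ, ← Finset.prod_const, Finset.prod_congr rfl h, Finset.prod_add,
    Finset.powerset_univ]
  refine Finset.sum_congr rfl fun C _ => ?_
  rw [← Real.exp_sum, ← Real.exp_sum, ← Real.exp_add, correlation, Finset.mul_sum,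
    ← Finset.sum_sdiff (Finset.subset_univ C), add_comm]
  congr 2
  · exact Finset.sum_congr rfl fun x hx => by simp [signOf, hx]
  · refine Finset.sum_congr rfl fun x hx => ?_
    have : signOf C x = -1 := by simp [signOf, (Finset.mem_sdiff.1 hx).2]
    rw [this]; ring

/-- Chernoff's bound for a sum of independent signs, as a count of sets. -/
lemma card_lt_correlation_le (S : Finset U) {t : ℝ} (hU : 0 < Fintype.card U) (ht : 0 ≤ t) :
    (({C : Finset U | t < correlation C S} : Finset _).card : ℝ) ≤
      2 ^ Fintype.card U * Real.exp (-(t ^ 2 / (2 * Fintype.card U))) := by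
  set n := Fintype.card U with hn
  have hn' : (0 : ℝ) < n := by exact_mod_cast hU
  -- the minimizer of `n * θ ^ 2 / 2 - θ * t`
  set θ := t / n
  have hθ : 0 ≤ θ := by positivity
  have h1 : (({C : Finset U | t < correlation C S} : Finset _).card : ℝ) * Real.exp (θ * t) ≤
      ∑ C : Finset U, Real.exp (θ * correlation C S) := by
    rw [← nsmul_eq_mul]
    refine (Finset.card_nsmul_le_sum _ (fun C => Real.exp (θ * correlation C S)) _ ?_).trans
      (Finset.sum_le_sum_of_subset_of_nonneg (Finset.subset_univ _)
        fun _ _ _ => (Real.exp_pos _).le)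
    intro C hC
    have := (Finset.mem_filter.1 hC).2
    gcongr
  have h2 : (2 * Real.cosh θ) ^ n ≤ 2 ^ n * Real.exp (n * (θ ^ 2 / 2)) := by
    rw [mul_pow, Real.exp_nat_mul]
    have := (Real.cosh_pos θ).le
    gcongr
    exact Real.cosh_le_exp_half_sq θ
  rw [sum_exp_correlation, ← hn] at h1
  rw [← mul_le_mul_iff_left₀ (Real.exp_pos (θ * t)), mul_assoc, ← Real.exp_add]
  refine (h1.trans h2).trans_eq ?_
  congr 2
  simp only [θ]
  field_simp
  ring

lemma card_lt_abs_correlation_le (S : Finset U) {t : ℝ} (hU : 0 < Fintype.card U) (ht : 0 ≤ t) :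
    (({C : Finset U | t < |correlation C S|} : Finset _).card : ℝ) ≤
      2 * (2 ^ Fintype.card U * Real.exp (-(t ^ 2 / (2 * Fintype.card U)))) := by
  have hsub : ({C : Finset U | t < |correlation C S|} : Finset _) ⊆
      ({C : Finset U | t < correlation C S} : Finset _) ∪
        ({C : Finset U | t < correlation C Sᶜ} : Finset _) := by
    intro C
    simp [lt_abs, correlation_compl]
  have h := (Finset.card_le_card hsub).trans (Finset.card_union_le _ _)
  have h' : (({C : Finset U | t < |correlation C S|} : Finset _).card : ℝ) ≤
      (({C : Finset U | t < correlation C S} : Finset _).card : ℝ) +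
        ({C : Finset U | t < correlation C Sᶜ} : Finset _).card := by exact_mod_cast h
  linarith [card_lt_correlation_le S hU ht, card_lt_correlation_le Sᶜ hU ht]

/-! ### Query procedures run on two functions -/

namespace QueryProc

/-- The sets that the procedure, answered by `f`, asks about in its first `K` queries, together with
its output if it stops within `K` queries. The truncation is needed because a query bound on other
functions says nothing about the length of the run on `f`. -/
def probes {U : Type*} [DecidableEq U] (f : Finset U → ℝ) : QueryProc U → ℕ → Finset (Finset U)
  | output S, _ => {S}
  | query _ _, 0 => ∅
  | query S next, K + 1 => insert S (probes f (next (f S)) K)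

lemma card_probes_le {U : Type*} [DecidableEq U] (f : Finset U → ℝ) (p : QueryProc U) (K : ℕ) :
    (p.probes f K).card ≤ K + 1 := by
  induction p generalizing K with
  | output S => simp [probes]
  | query S next ih =>
    cases K with
    | zero => simp [probes]
    | succ K => exact (Finset.card_insert_le _ _).trans (Nat.succ_le_succ (ih _ K))

/-- If `g` looks like `f` on the probed sets, the run on `g` follows the run on `f`; as the run
on `g` stops within `K` queries, its output is one of the probes. -/
lemma run_mem_probes {U : Type*} [DecidableEq U] {f g : Finset U → ℝ} {p : QueryProc U} {K : ℕ}
    (hfg : ∀ S ∈ p.probes f K, g S = f S) (hK : p.numQueries g ≤ K) :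
    p.run g ∈ p.probes f K := by
  induction p generalizing K with
  | output S => simp [probes, run]
  | query S next ih =>
    cases K with
    | zero => simp [numQueries] at hK
    | succ K =>
      simp only [probes, Finset.mem_insert, forall_eq_or_imp, numQueries, run] at *
      rw [hfg.1] at hK ⊢
      exact Or.inr (ih _ hfg.2 (by omega))

end QueryProc

/-! ### The hard instances -/

/-- The instance with objective `hiddenCut T C` and zero costs. Its threshold is the value of `C`,
and it depends on `C` only through the size of `C`. -/
noncomputable def hiddenInstance {T : ℝ} (hT : 0 ≤ T) (C : Finset U) : SubmodularCover U where
  f := hiddenCut T C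
  f_nonneg := hiddenCut_nonneg T C
  f_submodular := hiddenCut_submodular hT C
  w := 0
  w_nonneg := fun _ => le_rfl
  τ := cliqueCut C + excess T (Fintype.card U / 2)
  τ_le_max := ⟨C, by rw [hiddenCut, correlation_self]⟩

lemma RandQueryAlg.integrable_value (𝒜 : RandQueryAlg U) (I : SubmodularCover U) :
    Integrable (fun ω => I.f (𝒜.out I ω)) 𝒜.P := by
  let _ : MeasurableSpace (Finset U) := ⊤
  have hm : Measurable (𝒜.out I) :=
    measurable_to_countable' fun S => 𝒜.measurable_output I.w I.τ I.f S
  refine Integrable.of_bound (C := ∑ S, |I.f S|)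
    ((measurable_from_top (f := I.f)).comp hm).aestronglyMeasurable
    (Filter.Eventually.of_forall fun ω => ?_)
  exact Finset.single_le_sum (f := fun S => |I.f S|) (fun _ _ => abs_nonneg _) (Finset.mem_univ _)

/-- For a deterministic procedure making at most `K` queries, a set `C` whose correlation with none
of the probes of the run on the complete-graph cut is large yields an output of value at most `M`.
The other sets `C` are few, by the union bound over at most `K + 1` probes. -/
lemma sum_hiddenCut_run_le {T : ℝ} (hT : 0 ≤ T) (hU : 0 < Fintype.card U)
    (𝒞 : Finset (Finset U)) (p : QueryProc U) {K : ℕ}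
    (hK : ∀ C ∈ 𝒞, p.numQueries (hiddenCut T C) ≤ K) {M : ℝ} (hM : ∀ S : Finset U, cliqueCut S ≤ M) :
    ∑ C ∈ 𝒞, hiddenCut T C (p.run (hiddenCut T C)) ≤ 𝒞.card * M +
      (K + 1) * (2 * (2 ^ Fintype.card U * Real.exp (-((2 * T) ^ 2 / (2 * Fintype.card U))))) *
        excess T (Fintype.card U / 2) := by
  classical
  set δ := 2 * (2 ^ Fintype.card U * Real.exp (-((2 * T) ^ 2 / (2 * Fintype.card U))))
  set B := excess T (Fintype.card U / 2)
  have hB : 0 ≤ B := sq_nonneg _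
  set P := p.probes cliqueCut K
  set bad : Finset (Finset U) := P.biUnion fun S => {C : Finset U | 2 * T < |correlation C S|}
  have hbad : (bad.card : ℝ) ≤ (K + 1) * δ := by
    calc (bad.card : ℝ)
        ≤ ∑ S ∈ P, (({C : Finset U | 2 * T < |correlation C S|} : Finset _).card : ℝ) := by
          exact_mod_cast Finset.card_biUnion_le
      _ ≤ ∑ S ∈ P, δ :=
          Finset.sum_le_sum fun S _ => card_lt_abs_correlation_le S hU (by positivity)
      _ = P.card * δ := by simp
      _ ≤ (K + 1) * δ := by
          have : (P.card : ℝ) ≤ K + 1 := by exact_mod_cast p.card_probes_le cliqueCut K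
          gcongr
  have hpt : ∀ C ∈ 𝒞, hiddenCut T C (p.run (hiddenCut T C)) ≤ M + if C ∈ bad then B else 0 := by
    intro C hC
    split_ifs with h
    · refine add_le_add (hM _) (excess_le_of_abs_le ?_)
      rw [abs_div, abs_two]
      linarith [abs_correlation_le C (p.run (hiddenCut T C))]
    · have hagree : ∀ S ∈ P, hiddenCut T C S = cliqueCut S := by
        intro S hS
        have : ¬ 2 * T < |correlation C S| := fun hlt =>
          h (Finset.mem_biUnion.2 ⟨S, hS, by simpa using hlt⟩)
        rw [hiddenCut, excess_eq_zero, add_zero]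
        rw [abs_div, abs_two]
        linarith
      rw [hagree _ (QueryProc.run_mem_probes hagree (hK C hC)), add_zero]
      exact hM _
  refine (Finset.sum_le_sum hpt).trans ?_
  rw [Finset.sum_add_distrib, Finset.sum_const, nsmul_eq_mul, ← Finset.sum_filter,
    Finset.sum_const, nsmul_eq_mul]
  gcongr
  refine le_trans ?_ hbad
  exact_mod_cast Finset.card_le_card fun C hC => (Finset.mem_filter.1 hC).2

/-- The averaging step of Yao's principle: the bound for deterministic procedures is integrated over
the seed. -/
lemma sum_expectedValue_hiddenInstance_le {T : ℝ} (hT : 0 ≤ T) (hU : 0 < Fintype.card U)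
    (𝒜 : RandQueryAlg U) {m K : ℕ}
    (hK : ∀ (C : Finset U) (ω : 𝒜.Ω), 𝒜.queries (hiddenInstance hT C) ω ≤ K)
    {M : ℝ} (hM : ∀ S : Finset U, cliqueCut S ≤ M) :
    ∑ C ∈ Finset.powersetCard m Finset.univ, 𝒜.expectedValue (hiddenInstance hT C) ≤
      (Fintype.card U).choose m * M +
      (K + 1) * (2 * (2 ^ Fintype.card U * Real.exp (-((2 * T) ^ 2 / (2 * Fintype.card U))))) *
        excess T (Fintype.card U / 2) := by
  unfold RandQueryAlg.expectedValue
  rw [← integral_finsetSum _ fun C _ => 𝒜.integrable_value _]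
  refine (integral_mono (integrable_finsetSum _ fun C _ => 𝒜.integrable_value _)
    (integrable_const _) fun ω => ?_).trans_eq ((integral_const _).trans (by simp; rfl))
  -- The threshold is the same for all `C` of size `m`, so one procedure runs against all of them.
  set τ : ℝ := m * (Fintype.card U - m) + excess T (Fintype.card U / 2) with hτ
  have hI : ∀ C ∈ Finset.powersetCard m (Finset.univ : Finset U), (hiddenInstance hT C).τ = τ := by
    intro C hC
    rw [hτ, ← (Finset.mem_powersetCard.1 hC).2]
    rfl
  have hp : ∀ C ∈ Finset.powersetCard m (Finset.univ : Finset U),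
      𝒜.proc (hiddenInstance hT C).w (hiddenInstance hT C).τ ω = 𝒜.proc 0 τ ω := by
    intro C hC
    rw [hI C hC]; rfl
  have h := sum_hiddenCut_run_le hT hU (Finset.powersetCard m Finset.univ) (𝒜.proc 0 τ ω)
    (K := K) (fun C hC => by rw [← hp C hC]; exact hK C ω) hM
  rw [Finset.card_powersetCard, Finset.card_univ] at h
  refine le_trans (Finset.sum_le_sum fun C hC => ?_) h
  rw [← hp C hC]; rfl

/-- A uniform subset of `n` points has size `n / 2` with probability at least `1 / (n + 1)`. -/
lemma two_pow_le_mul_choose_half (n : ℕ) : 2 ^ n ≤ (n + 1) * n.choose (n / 2) := by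
  rw [← Nat.sum_range_choose]
  exact (Finset.sum_le_card_nsmul _ _ _ fun k _ => Nat.choose_le_middle k n).trans_eq (by simp)

/-- For `ε > 1 / 2` a constant objective suffices: every output has value equal to the threshold. -/
lemma exists_expectedValue_lt_of_half_lt (𝒜 : RandQueryAlg U) {ε : ℝ} (hε : 1 / 2 < ε) :
    ∃ I : SubmodularCover U, IsSymmetricSetFun I.f ∧
      𝒜.expectedValue I < (1 / 2 + ε) * I.τ := by
  let I : SubmodularCover U :=
    { f := fun _ => 1
      f_nonneg := fun _ => zero_le_one
      f_submodular := fun _ _ _ _ _ => le_rfl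
      w := 0
      w_nonneg := fun _ => le_rfl
      τ := 1
      τ_le_max := ⟨∅, le_rfl⟩ }
  refine ⟨I, fun _ => rfl, ?_⟩
  have : 𝒜.expectedValue I = 1 := by simp [RandQueryAlg.expectedValue, I]
  rw [this]
  change 1 < (1 / 2 + ε) * 1
  linarith

end

/-! ### Asymptotics -/

lemma eventually_mul_exp_neg_lt {a γ : ℝ} (ha : 0 < a) (hγ : 0 < γ) :
    ∀ᶠ n : ℕ in Filter.atTop, 4 * ((n : ℝ) + 1) * Real.exp (-(a * n)) < γ := by
  have hr : |Real.exp (-a)| < 1 := by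
    rw [abs_of_pos (Real.exp_pos _), Real.exp_lt_one_iff]; linarith
  have h := ((tendsto_pow_const_mul_const_pow_of_abs_lt_one 1 hr).add
    (tendsto_pow_atTop_nhds_zero_of_abs_lt_one hr)).const_mul 4
  rw [add_zero, mul_zero] at h
  filter_upwards [h.eventually_lt_const hγ] with n hn
  refine lt_of_eq_of_lt ?_ hn
  rw [← Real.exp_nat_mul, show (n : ℝ) * -a = -(a * n) by ring]
  ring

/-- With slack parameter `T = 3 / 4 * ε * n`, the average value of the output over hidden sets of
size `n / 2` stays below `1 / 2 + ε` times the threshold. -/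
lemma eventually_average_lt {ε : ℝ} (hε : 0 < ε) (hε' : ε ≤ 1 / 2) :
    ∀ᶠ n : ℕ in Filter.atTop, ∀ K : ℕ,
      (K : ℝ) ≤ Real.log (1 + ε) * Real.exp (ε ^ 2 * n) / Real.log n →
      (n.choose (n / 2) : ℝ) * ((n / 2 : ℕ) * ((n : ℝ) - (n / 2 : ℕ))) +
        (K + 1) * (2 * (2 ^ n * Real.exp (-((2 * (3 / 4 * ε * n)) ^ 2 / (2 * n))))) *
          excess (3 / 4 * ε * n) (n / 2) <
      n.choose (n / 2) * ((1 / 2 + ε) *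
        ((n / 2 : ℕ) * ((n : ℝ) - (n / 2 : ℕ)) + excess (3 / 4 * ε * n) (n / 2))) := by
  -- `β` and `γ` are, in units of `n ^ 2`, the height of the bump and the margin left when no
  -- probe meets the bump
  set β : ℝ := (1 / 2 - 3 / 4 * ε) ^ 2 with hβ
  have hβ1 : β ≤ 1 := by rw [hβ]; nlinarith
  have hβ0 : 0 ≤ β := sq_nonneg _
  set γ : ℝ := (1 / 2 + ε) * β - (1 / 2 - ε) / 4 with hγ
  have hγ0 : 0 < γ := by
    have : γ = ε / 8 * (9 / 2 * (ε - 5 / 12) ^ 2 + 7 / 32) := by rw [hγ, hβ]; ring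
    rw [this]; positivity
  filter_upwards [eventually_mul_exp_neg_lt (a := ε ^ 2 / 8) (by positivity) hγ0,
    Filter.eventually_ge_atTop 3] with n hn h3 K hK
  have h3' : (3 : ℝ) ≤ n := by exact_mod_cast h3
  set N : ℝ := ((n.choose (n / 2) : ℕ) : ℝ)
  have hN : 0 < N := by
    have := Nat.choose_pos (Nat.div_le_self n 2)
    exact Nat.cast_pos.2 this
  set M : ℝ := (n / 2 : ℕ) * ((n : ℝ) - (n / 2 : ℕ))
  have hM : M ≤ n ^ 2 / 4 := by
    simp only [M]
    nlinarith [sq_nonneg ((n : ℝ) - 2 * (n / 2 : ℕ))]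
  have hB : excess (3 / 4 * ε * n) (n / 2) = β * n ^ 2 := by
    rw [excess, abs_of_nonneg (by positivity), max_eq_left (by nlinarith)]
    ring
  -- the factor `1 / log n` is not needed: the tail already beats `exp (ε ^ 2 * n)`
  have hK1 : (K : ℝ) + 1 ≤ 2 * Real.exp (ε ^ 2 * n) := by
    have hlog : 1 ≤ Real.log n := by
      rw [Real.le_log_iff_exp_le (by linarith)]
      linarith [Real.exp_one_lt_d9]
    have hlog' : Real.log (1 + ε) ≤ 1 := by
      linarith [Real.log_le_sub_one_of_pos (show 0 < 1 + ε by linarith)]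
    have : Real.log (1 + ε) * Real.exp (ε ^ 2 * n) / Real.log n ≤ Real.exp (ε ^ 2 * n) := by
      rw [div_le_iff₀ (by linarith), mul_comm]
      gcongr
      linarith
    linarith [Real.one_le_exp (show 0 ≤ ε ^ 2 * n by positivity)]
  have hfail : (K + 1) * (2 * (2 ^ n * Real.exp (-((2 * (3 / 4 * ε * n)) ^ 2 / (2 * n))))) ≤
      N * (4 * ((n : ℝ) + 1) * Real.exp (-(ε ^ 2 / 8 * n))) := by
    have h2 : (2 : ℝ) ^ n ≤ (n + 1) * N := by
      simp only [N]; exact_mod_cast two_pow_le_mul_choose_half n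
    calc _ ≤ 2 * Real.exp (ε ^ 2 * n) * (2 * ((n + 1) * N *
          Real.exp (-((2 * (3 / 4 * ε * n)) ^ 2 / (2 * n))))) := by gcongr
      _ = 4 * ((n + 1) * N) * (Real.exp (ε ^ 2 * n) *
          Real.exp (-((2 * (3 / 4 * ε * n)) ^ 2 / (2 * n)))) := by ring
      _ = _ := by
          rw [← Real.exp_add, show ε ^ 2 * (n : ℝ) + -((2 * (3 / 4 * ε * n)) ^ 2 / (2 * n)) =
            -(ε ^ 2 / 8 * n) by field_simp; ring]
          ring
  rw [hB]
  have hstep : (K + 1) * (2 * (2 ^ n * Real.exp (-((2 * (3 / 4 * ε * n)) ^ 2 / (2 * n))))) *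
      (β * n ^ 2) < N * (γ * n ^ 2) := by
    set q := 4 * ((n : ℝ) + 1) * Real.exp (-(ε ^ 2 / 8 * n))
    have hq : 0 ≤ q := by positivity
    calc _ ≤ N * q * (β * n ^ 2) := by gcongr
      _ ≤ N * q * (1 * n ^ 2) := by gcongr
      _ = N * (q * n ^ 2) := by ring
      _ < N * (γ * n ^ 2) := by gcongr
  have hgain : M + γ * n ^ 2 ≤ (1 / 2 + ε) * (M + β * n ^ 2) := by
    rw [hγ]; nlinarith
  nlinarith [mul_le_mul_of_nonneg_left hgain hN.le]

theorem theorem1 :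
    ∃ c : ℝ, 0 < c ∧ ∀ ε : ℝ, 0 < ε → ∃ N : ℕ, ∀ n : ℕ, N ≤ n →
      ¬ ∃ 𝒜 : RandQueryAlg (Fin n), ∀ I : SubmodularCover (Fin n), IsSymmetricSetFun I.f →
        (∀ ω : 𝒜.Ω,
          (𝒜.queries I ω : ℝ) < c * (Real.log (1 + ε) * Real.exp (ε ^ 2 * n) / Real.log n)) ∧
        (1 / 2 + ε) * I.τ ≤ 𝒜.expectedValue I := by
  refine ⟨1, one_pos, fun ε hε => ?_⟩
  rcases lt_or_ge (1 / 2) ε with hlt | hle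
  · refine ⟨0, fun n _ => ?_⟩
    rintro ⟨𝒜, h𝒜⟩
    obtain ⟨I, hI, hval⟩ := exists_expectedValue_lt_of_half_lt 𝒜 hlt
    exact hval.not_ge (h𝒜 I hI).2
  obtain ⟨N, hN⟩ := Filter.eventually_atTop.1 (eventually_average_lt hε hle)
  refine ⟨max N 1, fun n hn => ?_⟩
  rintro ⟨𝒜, h𝒜⟩
  have hT : 0 ≤ 3 / 4 * ε * n := by positivity
  set Q := Real.log (1 + ε) * Real.exp (ε ^ 2 * n) / Real.log n
  have hQ : 0 ≤ Q := div_nonneg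
    (mul_nonneg (Real.log_nonneg (by linarith)) (Real.exp_pos _).le) (Real.log_natCast_nonneg n)
  have h (C : Finset (Fin n)) := h𝒜 (hiddenInstance hT C) (hiddenCut_symm _ C)
  have hcard : Fintype.card (Fin n) = n := Fintype.card_fin n
  have hupper := sum_expectedValue_hiddenInstance_le hT (by rw [hcard]; omega) 𝒜
    (m := n / 2) (K := ⌊Q⌋₊)
    (fun C ω => Nat.le_floor (by simpa only [one_mul] using ((h C).1 ω).le)) cliqueCut_le
  have hlower : (n.choose (n / 2) : ℝ) * ((1 / 2 + ε) *
      ((n / 2 : ℕ) * ((n : ℝ) - (n / 2 : ℕ)) + excess (3 / 4 * ε * n) (n / 2))) ≤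
      ∑ C ∈ Finset.powersetCard (n / 2) Finset.univ, 𝒜.expectedValue (hiddenInstance hT C) := by
    have hsize : (Finset.powersetCard (n / 2) (Finset.univ : Finset (Fin n))).card =
        n.choose (n / 2) := by rw [Finset.card_powersetCard, Finset.card_univ, hcard]
    rw [← nsmul_eq_mul, ← hsize]
    refine Finset.card_nsmul_le_sum _ _ _ fun C hC => ?_
    have := (h C).2
    change (1 / 2 + ε) * (cliqueCut C + excess _ _) ≤ _ at this
    simp only [cliqueCut, (Finset.mem_powersetCard.1 hC).2, hcard] at this
    exact this
  rw [hcard] at hupper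
  exact (hlower.trans hupper).not_gt (hN n (le_of_max_le_left hn) _ (Nat.floor_le hQ))
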